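/- Words over the alphabets $\{0,1\}$ and $\{0,1,2,3,4\}$ are considered. A factor of a (one-sided or bi-infinite) infinite word is a finite block of consecutive letters of it, and its factor set is the set of all its factors. A square is a word $uu$ with $u$ non-empty. A repetition is a word $u^n v$ with $u$ non-empty and $v$ a prefix of $u$; its exponent is $|u^n v|/|u|$, and an overlap is a repetition of exponent strictly greater than $2$. Let $b_5 = 0123421\cdots$ be the infinite word starting with $0$ that is the fixed point of the morphism $0\mapsto 01$, $1\mapsto 23$, $2\mapsto 4$, $3\mapsto 21$, $4\mapsto 0$, and let $h_{12}$ be the morphism $0\mapsto 0011$, $1\mapsto 01$, $2\mapsto 001$, $3\mapsto 011$, $4\mapsto\varepsilon$ (the empty word). **Theorem.** Every bi-infinite binary word that contains no overlap other than $01010$ and contains at most $12$ distinct squares as factors has the same factor set as $h_{12}(b_5)$. -/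

import Mathlib

namespace Words

variable {α β : Type*}

/-! ### Finite words: repetitions, squares, overlaps -/

/-- `r` is a repetition `uⁿv` with `u` non-empty and `v` a prefix of `u`; its period is `|u|`
and its exponent is `|r| / |u|`. -/
def IsRepetition (u r : List α) : Prop :=
  u ≠ [] ∧ ∃ (n : ℕ) (v : List α), v <+: u ∧ r = (List.replicate n u).flatten ++ v

/-- An overlap is a repetition of exponent strictly greater than `2`. -/
def IsOverlap (r : List α) : Prop :=
  ∃ u : List α, IsRepetition u r ∧ 2 < (r.length : ℚ) / (u.length : ℚ)

/-- A square is a word `uu` with `u` non-empty. -/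
def IsSquareWord (r : List α) : Prop :=
  ∃ u : List α, u ≠ [] ∧ r = u ++ u

/-! ### Infinite and bi-infinite words and their factors -/

/-- The set of finite factors of the bi-infinite word `w`. -/
def biFactors (w : ℤ → α) : Set (List α) :=
  {u | ∃ (i : ℤ) (n : ℕ), u = (List.range n).map fun k : ℕ => w (i + k)}

/-- The set of finite factors of the (right-)infinite word `x`. -/
def factors (x : ℕ → α) : Set (List α) :=
  {u | ∃ i n : ℕ, u = (List.range n).map fun k : ℕ => x (i + k)}

/-- The prefix of length `n` of the infinite word `x`. -/
def pre (x : ℕ → α) (n : ℕ) : List α := (List.range n).map x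

/-! ### Morphisms -/

/-- The morphism of free monoids which is given by the images `f a` of the letters. -/
def applyMorphism (f : α → List β) (u : List α) : List β := u.flatMap f

open Classical in
/-- The image `f(x) = f(x₀) f(x₁) f(x₂) ⋯` of an infinite word under a (possibly erasing) morphism.
Letters beyond the end of `f(x)` (if it is finite) get a default value. -/
noncomputable def image [Inhabited β] (f : α → List β) (x : ℕ → α) : ℕ → β := fun n =>
  if h : ∃ k, n < (applyMorphism f (pre x k)).length then
    (applyMorphism f (pre x (Nat.find h)))[n]'(Nat.find_spec h)
  else default

/-- The morphism `01/23/4/21/0` on five letters. -/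
def phi5 : Fin 5 → List (Fin 5) := ![[0, 1], [2, 3], [4], [2, 1], [0]]

/-- The infinite word `b₅`, the fixed point `φ^ω(0)` of `φ = 01/23/4/21/0`: its `n`-th letter is the
`n`-th letter of `φⁿ(0)`, a word of length greater than `n`. -/
def b5 : ℕ → Fin 5 := fun n => ((applyMorphism phi5)^[n] [0]).getD n 0

/-- The morphism `0011/01/001/011/ε` from five letters to two letters. -/
def h12 : Fin 5 → List (Fin 2) := ![[0, 0, 1, 1], [0, 1], [0, 0, 1], [0, 1, 1], []]

/-! ### Sanity checks: `b₅` is the fixed point, and `h₁₂(b₅)` is an infinite word -/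

theorem applyMorphism_append (f : α → List β) (u v : List α) :
    applyMorphism f (u ++ v) = applyMorphism f u ++ applyMorphism f v := by
  simp [applyMorphism]

theorem applyMorphism_prefix (f : α → List β) {u v : List α} (h : u <+: v) :
    applyMorphism f u <+: applyMorphism f v := by
  obtain ⟨t, rfl⟩ := h
  exact ⟨applyMorphism f t, (applyMorphism_append f u t).symm⟩

theorem pre_length (x : ℕ → α) (n : ℕ) : (pre x n).length = n := by simp [pre]

theorem pre_prefix (x : ℕ → α) {k l : ℕ} (h : k ≤ l) : pre x k <+: pre x l := by
  obtain ⟨d, rfl⟩ := Nat.exists_eq_add_of_le h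
  refine ⟨(List.range d).map fun i => x (k + i), ?_⟩
  simp [pre, List.range_add]

theorem image_eq [Inhabited β] (f : α → List β) (x : ℕ → α) {n k : ℕ}
    (h : n < (applyMorphism f (pre x k)).length) :
    image f x n = (applyMorphism f (pre x k))[n] := by
  classical
  have hex : ∃ k, n < (applyMorphism f (pre x k)).length := ⟨k, h⟩
  unfold image
  rw [dif_pos hex]
  have hp := applyMorphism_prefix f (pre_prefix x (Nat.find_min' hex h))
  convert hp.getElem (Nat.find_spec hex) using 2

/-- The images of the prefixes of `x` are prefixes of the image of `x`. -/
theorem pre_image [Inhabited β] (f : α → List β) (x : ℕ → α) (k : ℕ) :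
    pre (image f x) (applyMorphism f (pre x k)).length = applyMorphism f (pre x k) := by
  apply List.ext_getElem
  · simp [pre]
  · intro i h1 h2
    simpa [pre] using image_eq f x h2

theorem iterate_append (f : α → List α) (n : ℕ) (u v : List α) :
    (applyMorphism f)^[n] (u ++ v) = (applyMorphism f)^[n] u ++ (applyMorphism f)^[n] v := by
  induction n generalizing u v with
  | zero => rfl
  | succ n ih => simp only [Function.iterate_succ, Function.comp, applyMorphism_append, ih]

theorem phi5_iterate_succ (n : ℕ) : (applyMorphism phi5)^[n + 1] [0] =
    (applyMorphism phi5)^[n] [0] ++ (applyMorphism phi5)^[n] [1] := by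
  rw [← iterate_append, Function.iterate_succ]
  rfl

theorem phi5_iterate_one (n : ℕ) :
    ∃ (u : List (Fin 5)) (a : Fin 5), (a = 1 ∨ a = 3) ∧ (applyMorphism phi5)^[n] [1] = u ++ [a] := by
  induction n with
  | zero => exact ⟨[], 1, by simp, rfl⟩
  | succ n ih =>
    obtain ⟨u, a, ha, h⟩ := ih
    rw [Function.iterate_succ_apply', h, applyMorphism_append]
    rcases ha with rfl | rfl
    · exact ⟨applyMorphism phi5 u ++ [2], 3, by simp, by simp [applyMorphism, phi5]⟩
    · exact ⟨applyMorphism phi5 u ++ [2], 1, by simp, by simp [applyMorphism, phi5]⟩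

theorem phi5_iterate_length (n : ℕ) : n < ((applyMorphism phi5)^[n] [0]).length := by
  induction n with
  | zero => simp
  | succ n ih =>
    obtain ⟨u, a, -, h⟩ := phi5_iterate_one n
    rw [phi5_iterate_succ, h]
    simp only [List.length_append, List.length_cons, List.length_nil]
    omega

theorem phi5_iterate_prefix {m n : ℕ} (h : m ≤ n) :
    (applyMorphism phi5)^[m] [0] <+: (applyMorphism phi5)^[n] [0] := by
  induction n, h using Nat.le_induction with
  | base => exact List.prefix_refl _
  | succ n _ ih => exact ih.trans (phi5_iterate_succ n ▸ List.prefix_append _ _)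

/-- The words `φⁿ(0)` are prefixes of `b₅`. -/
theorem pre_b5 (n : ℕ) :
    pre b5 ((applyMorphism phi5)^[n] [0]).length = (applyMorphism phi5)^[n] [0] := by
  apply List.ext_getElem
  · simp [pre]
  · intro i h1 h2
    have h3 := phi5_iterate_length i
    simp only [pre, List.getElem_map, List.getElem_range, b5]
    rw [List.getD_eq_getElem _ _ h3]
    rcases le_total i n with h | h
    · exact (phi5_iterate_prefix h).getElem h3
    · exact ((phi5_iterate_prefix h).getElem h2).symm

/-- `b₅` is a fixed point of `01/23/4/21/0` that starts with `0`. -/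
theorem b5_fixed : b5 0 = 0 ∧ image phi5 b5 = b5 := by
  refine ⟨rfl, ?_⟩
  funext n
  have h1 := pre_b5 n
  have h2 := pre_b5 (n + 1)
  have h3 := pre_image phi5 b5 ((applyMorphism phi5)^[n] [0]).length
  rw [h1, ← Function.iterate_succ_apply' (applyMorphism phi5)] at h3
  have hl : n < ((applyMorphism phi5)^[n + 1] [0]).length :=
    (Nat.lt_succ_self n).trans (phi5_iterate_length (n + 1))
  have h4 := congrArg (fun l => l[n]?) (h3.trans h2.symm)
  generalize ((applyMorphism phi5)^[n + 1] [0]).length = m at hl h4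
  simpa [pre, hl] using h4

/-- The images under `h₁₂` of the prefixes of `b₅` are arbitrarily long. -/
theorem h12_b5_length (n : ℕ) : ∃ k, n < (applyMorphism h12 (pre b5 k)).length := by
  refine ⟨((applyMorphism phi5)^[n] [0]).length, ?_⟩
  rw [pre_b5]
  induction n with
  | zero => simp [applyMorphism, h12]
  | succ n ih =>
    obtain ⟨u, a, ha, h⟩ := phi5_iterate_one n
    have h2 : 1 ≤ (h12 a).length := by rcases ha with rfl | rfl <;> simp [h12]
    rw [phi5_iterate_succ, h, applyMorphism_append, applyMorphism_append]
    simp only [List.length_append]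
    simp only [applyMorphism, List.flatMap_cons, List.flatMap_nil, List.append_nil] at *
    omega

end Words

/-! Everything uses only the factor set `L`, which is closed under factors and two-sided extendable.
An exhaustive search shows that 26 explicit words do not lie in `L` (`refuteAll_sound`,
`refuteAll_forbidden`): every way to extend such a word on both sides soon meets a prohibited
overlap, a thirteenth square or a word already refuted.

Although `h12` erases the letter 4, the images of the letters under `h12phi` are non-empty and all
begin with 0011. Once the 26 words are excluded, occurrences of 0011 cut the words of `L` into these
blocks, and the words over five letters read off form a square-free extendable language avoiding
`b5Forbidden` (`isB5Language_desubstitution_h12phi`). Such languages can be desubstituted by `phi5`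
again and again (`IsB5Language.desubstitution`).

Hence for every n each word of `L` lies in the image of some φⁿ(v). For large n a v of length at
most two suffices, and the admissible pairs of letters all occur in `b5`; so `L` contains only
factors of `h12(b5)`. Conversely φ³(a) contains 0 for every letter a, so the image of any letter
under a high power of φ contains a long prefix of `b5`, and all factors of `h12(b5)` occur
(`eq_factors`). -/

namespace Words

/-! ### Extendable languages and desubstitution at markers -/

section Languages

variable {α β : Type*}

/-- A non-empty language that is closed under factors and in which every word extends to both
sides. -/
structure IsExtendable (L : Set (List α)) : Prop where
  nil_mem : [] ∈ L
  mem_of_infix : ∀ {u v : List α}, u <:+: v → v ∈ L → u ∈ L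
  exists_cons : ∀ {u : List α}, u ∈ L → ∃ a, a :: u ∈ L
  exists_concat : ∀ {u : List α}, u ∈ L → ∃ a, u ++ [a] ∈ L

theorem mem_biFactors {w : ℤ → α} {u : List α} :
    u ∈ biFactors w ↔ ∃ i : ℤ, ∀ (k : ℕ) (h : k < u.length), u[k] = w (i + k) := by
  constructor
  · rintro ⟨i, n, rfl⟩
    exact ⟨i, fun k h => by simp⟩
  · rintro ⟨i, h⟩
    exact ⟨i, u.length, List.ext_getElem (by simp) fun k h1 h2 => by simp [h k h1]⟩

theorem isExtendable_biFactors (w : ℤ → α) : IsExtendable (biFactors w) where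
  nil_mem := ⟨0, 0, rfl⟩
  mem_of_infix := by
    rintro u v ⟨s, t, rfl⟩ hv
    obtain ⟨i, h⟩ := mem_biFactors.1 hv
    refine mem_biFactors.2 ⟨i + s.length, fun k hk => ?_⟩
    have := h (s.length + k) (by simp; omega)
    rw [List.getElem_append_left (by simp; omega), List.getElem_append_right (by omega)] at this
    simpa [add_assoc] using this
  exists_cons := by
    intro u hu
    obtain ⟨i, h⟩ := mem_biFactors.1 hu
    refine ⟨w (i - 1), mem_biFactors.2 ⟨i - 1, fun k hk => ?_⟩⟩
    cases k with
    | zero => simp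
    | succ k =>
      simp only [List.getElem_cons_succ]
      rw [h k (by simpa using hk)]
      congr 1
      push_cast
      ring
  exists_concat := by
    intro u hu
    obtain ⟨i, h⟩ := mem_biFactors.1 hu
    refine ⟨w (i + u.length), mem_biFactors.2 ⟨i, fun k hk => ?_⟩⟩
    by_cases hk' : k < u.length
    · rw [List.getElem_append_left hk', h k hk']
    · have : k = u.length := by simp at hk; omega
      subst this
      simp

theorem IsExtendable.exists_append_left {L : Set (List α)} (hL : IsExtendable L) {u : List α}
    (hu : u ∈ L) (n : ℕ) : ∃ s : List α, s.length = n ∧ s ++ u ∈ L := by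
  induction n with
  | zero => exact ⟨[], rfl, hu⟩
  | succ n ih =>
    obtain ⟨s, hs, h⟩ := ih
    obtain ⟨a, ha⟩ := hL.exists_cons h
    exact ⟨a :: s, by simp [hs], ha⟩

theorem IsExtendable.exists_append_right {L : Set (List α)} (hL : IsExtendable L) {u : List α}
    (hu : u ∈ L) (n : ℕ) : ∃ s : List α, s.length = n ∧ u ++ s ∈ L := by
  induction n with
  | zero => exact ⟨[], rfl, by simpa using hu⟩
  | succ n ih =>
    obtain ⟨s, hs, h⟩ := ih
    obtain ⟨a, ha⟩ := hL.exists_concat h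
    exact ⟨s ++ [a], by simp [hs], by simpa using ha⟩

/-- The words `v` such that `f v` occurs in `L` in front of a marker. -/
def desubstitution (f : α → List β) (T : List (List β)) (L : Set (List β)) : Set (List α) :=
  {v | ∃ m ∈ T, applyMorphism f v ++ m ∈ L}

/-- The words of `L` can be cut uniquely at the markers in `T` into the blocks `f a`. -/
structure IsCut (f : α → List β) (T : List (List β)) (N : ℕ) (L : Set (List β)) : Prop where
  ne_nil : ∀ a, f a ≠ []
  marker_prefix : ∀ a, ∀ m ∈ T, ∃ m' ∈ T, m' <+: f a ++ m
  length_le : ∀ m ∈ T, m.length ≤ N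
  exists_marker : ∀ u ∈ L, u.length = N → ∃ m ∈ T, m <:+: u
  right : ∀ u ∈ L, u.length = N → ∀ m ∈ T, m <+: u → ∃ a, ∃ m' ∈ T, f a ++ m' <+: u
  left : ∀ u ∈ L, u.length = N → ∀ m ∈ T, m <:+ u → ∃ a, f a ++ m <:+ u

variable {f : α → List β} {T : List (List β)} {N : ℕ} {L : Set (List β)}

theorem applyMorphism_cons (f : α → List β) (a : α) (u : List α) :
    applyMorphism f (a :: u) = f a ++ applyMorphism f u := rfl

theorem applyMorphism_infix (f : α → List β) {u v : List α} (h : u <:+: v) :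
    applyMorphism f u <:+: applyMorphism f v := by
  obtain ⟨s, t, rfl⟩ := h
  exact ⟨applyMorphism f s, applyMorphism f t, by simp only [applyMorphism_append]⟩

theorem IsCut.exists_prefix (h : IsCut f T N L) (v : List α) {m : List β} (hm : m ∈ T) :
    ∃ m' ∈ T, m' <+: applyMorphism f v ++ m := by
  cases v with
  | nil => exact ⟨m, hm, List.prefix_refl _⟩
  | cons a v =>
    obtain ⟨m1, hm1, h1⟩ := h.exists_prefix v hm
    obtain ⟨m2, hm2, h2⟩ := h.marker_prefix a m1 hm1
    refine ⟨m2, hm2, h2.trans ?_⟩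
    rw [applyMorphism_cons, List.append_assoc]
    exact (List.prefix_append_right_inj _).2 h1

theorem applyMorphism_mem_of_mem_desubstitution (hL : IsExtendable L) {v : List α}
    (hv : v ∈ desubstitution f T L) : applyMorphism f v ∈ L := by
  obtain ⟨m, -, hm⟩ := hv
  exact hL.mem_of_infix (List.prefix_append _ _).isInfix hm

/-- Every `f v ++ m` begins with a marker. So when letters are cut off on the right, what follows
the remainder supplies its marker, and an extension to the left can be cut in front of the initial
marker. -/
theorem IsCut.isExtendable (h : IsCut f T N L) (hL : IsExtendable L) :
    IsExtendable (desubstitution f T L) where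
  nil_mem := by
    obtain ⟨s, hs, hsL⟩ := hL.exists_append_left hL.nil_mem N
    rw [List.append_nil] at hsL
    obtain ⟨m, hm, hms⟩ := h.exists_marker s hsL hs
    exact ⟨m, hm, hL.mem_of_infix hms hsL⟩
  mem_of_infix := by
    rintro u v ⟨s, t, rfl⟩ ⟨m, hm, hv⟩
    obtain ⟨m', hm', r, hr⟩ := h.exists_prefix t hm
    refine ⟨m', hm', hL.mem_of_infix ⟨applyMorphism f s, r, ?_⟩ hv⟩
    simp only [applyMorphism_append, List.append_assoc, hr]
  exists_cons := by
    rintro v ⟨m, hm, hv⟩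
    obtain ⟨m', hm', r, hr⟩ := h.exists_prefix v hm
    obtain ⟨s, hs, hsL⟩ := hL.exists_append_left hv N
    rw [← hr, ← List.append_assoc] at hsL
    -- Since `s` has length `N`, this is the window of length `N` that ends in the marker.
    have h1 : (s ++ m').drop m'.length <:+ s ++ m' := List.drop_suffix _ _
    have h2 : m' <:+ (s ++ m').drop m'.length := by
      rw [List.drop_append_of_le_length (by rw [hs]; exact h.length_le _ hm')]
      exact List.suffix_append _ _
    obtain ⟨a, ha⟩ := h.left _ (hL.mem_of_infix (h1.isInfix.trans (List.prefix_append _ _).isInfix) hsL)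
      (by simp [hs]) m' hm' h2
    obtain ⟨q, hq⟩ := ha.trans h1
    refine ⟨a, m, hm, hL.mem_of_infix ⟨q, [], ?_⟩ hsL⟩
    rw [← hq, applyMorphism_cons, List.append_assoc (f a), ← hr]
    simp
  exists_concat := by
    rintro v ⟨m, hm, hv⟩
    obtain ⟨s, hs, hsL⟩ := hL.exists_append_right hv N
    rw [List.append_assoc] at hsL
    have h1 : (m ++ s).take N <+: m ++ s := List.take_prefix _ _
    have h2 : m <+: (m ++ s).take N :=
      List.prefix_of_prefix_length_le (List.prefix_append _ _) h1
        (by simp [hs]; exact h.length_le _ hm)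
    obtain ⟨a, m', hm', ha⟩ := h.right _
      (hL.mem_of_infix (h1.isInfix.trans (List.suffix_append _ _).isInfix) hsL) (by simp [hs]) m hm h2
    obtain ⟨q, hq⟩ := ha.trans h1
    refine ⟨a, m', hm', hL.mem_of_infix ⟨[], q, ?_⟩ hsL⟩
    rw [← hq, applyMorphism_append]
    simp [applyMorphism]

/-- Greedy parsing: blocks are split off from the left until at most `N` letters remain. -/
theorem IsCut.exists_parse (h : IsCut f T N L) (hL : IsExtendable L) (n : ℕ) :
    ∀ x ∈ L, x.length ≤ n → ∀ m ∈ T, m <+: x →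
      ∃ v, ∃ m' ∈ T, applyMorphism f v ++ m' <+: x ∧ x.length < (applyMorphism f v).length + N + 1 := by
  induction n with
  | zero =>
    intro x _ hn m hm hmx
    exact ⟨[], m, hm, hmx, by omega⟩
  | succ n ih =>
    intro x hx hn m hm hmx
    by_cases hN : x.length ≤ N
    · exact ⟨[], m, hm, hmx, by omega⟩
    · push Not at hN
      have h1 : x.take N <+: x := List.take_prefix _ _
      have hlen : (x.take N).length = N := by simp; omega
      obtain ⟨a, m', hm', ha⟩ := h.right _ (hL.mem_of_infix h1.isInfix hx) hlen m hm
        (List.prefix_of_prefix_length_le hmx h1 (by rw [hlen]; exact h.length_le _ hm))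
      obtain ⟨q, rfl⟩ := ha.trans h1
      have hpos := List.length_pos_iff.2 (h.ne_nil a)
      rw [List.append_assoc] at hx hn ⊢
      obtain ⟨v, m2, hm2, hv, hl⟩ := ih (m' ++ q) (hL.mem_of_infix (List.suffix_append _ _).isInfix hx)
        (by simp only [List.length_append] at hn ⊢; omega) m' hm' (List.prefix_append _ _)
      refine ⟨a :: v, m2, hm2, ?_, ?_⟩
      · rw [applyMorphism_cons, List.append_assoc]
        exact (List.prefix_append_right_inj _).2 hv
      · rw [applyMorphism_cons]
        simp only [List.length_append] at hl ⊢
        omega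

/-- Padding by `N` letters on the left provides a marker at which parsing starts; `N` letters on the
right absorb the unparsed rest, so the parsed part covers `u`. -/
theorem IsCut.exists_infix (h : IsCut f T N L) (hL : IsExtendable L) {u : List β} (hu : u ∈ L) :
    ∃ v ∈ desubstitution f T L, u <:+: applyMorphism f v := by
  obtain ⟨s, hs, hsL⟩ := hL.exists_append_left hu N
  obtain ⟨t, ht, htL⟩ := hL.exists_append_right hsL N
  obtain ⟨m, hm, s1, s2, hms⟩ := h.exists_marker s
    (hL.mem_of_infix (List.prefix_append _ _).isInfix hsL) hs
  have hx : m ++ s2 ++ u ++ t ∈ L := hL.mem_of_infix ⟨s1, [], by simp [← hms]⟩ htL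
  obtain ⟨v, m', hm', hv, hl⟩ := h.exists_parse hL _ _ hx le_rfl m hm
    (by simp only [List.append_assoc]; exact List.prefix_append _ _)
  refine ⟨v, ⟨m', hm', hL.mem_of_infix hv.isInfix hx⟩, ?_⟩
  have h1 : m ++ s2 ++ u <+: applyMorphism f v :=
    List.prefix_of_prefix_length_le (List.prefix_append _ t)
      ((List.prefix_append _ _).trans hv) (by
        simp only [List.length_append] at hl ⊢
        omega)
  exact (List.suffix_append _ _).isInfix.trans h1.isInfix

end Languages

/-! ### Binary words as numbers -/

section Code

/-- A binary word as a number: the first letter is the lowest bit, and a leading bit `1` marks the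
end of the word. -/
def code : List (Fin 2) → ℕ
  | [] => 1
  | b :: u => 2 * code u + b

theorem code_pos : ∀ u, 0 < code u
  | [] => Nat.one_pos
  | b :: u => by have := code_pos u; simp only [code]; omega

theorem code_injective : Function.Injective code := by
  intro u
  induction u with
  | nil =>
    rintro (_ | ⟨b, v⟩) h
    · rfl
    · have := code_pos v
      simp only [code] at h
      omega
  | cons a u ih =>
    rintro (_ | ⟨b, v⟩) h
    · have := code_pos u
      simp only [code] at h
      omega
    · simp only [code] at h
      have ha := a.isLt
      have hb := b.isLt
      rw [ih (show code u = code v by omega), Fin.ext (show (a : ℕ) = b by omega)]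

theorem code_concat (u : List (Fin 2)) (b : Fin 2) :
    code (u ++ [b]) = code u + 2 ^ u.length * (b + 1) := by
  induction u with
  | nil => simp [code]; omega
  | cons a u ih =>
    simp only [List.cons_append, code, ih, List.length_cons, pow_succ]
    ring

theorem code_drop (u : List (Fin 2)) {s : ℕ} (h : s ≤ u.length) : code (u.drop s) = code u / 2 ^ s := by
  induction s generalizing u with
  | zero => simp
  | succ s ih =>
    cases u with
    | nil => simp at h
    | cons b u =>
      rw [List.drop_succ_cons, ih u (by simpa using h), code, pow_succ', ← Nat.div_div_eq_div_mul]
      congr 1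
      omega

theorem code_take (u : List (Fin 2)) {s : ℕ} (h : s ≤ u.length) :
    code (u.take s) = code u % 2 ^ s + 2 ^ s := by
  induction s generalizing u with
  | zero => simp [code, Nat.mod_one]
  | succ s ih =>
    cases u with
    | nil => simp at h
    | cons b u =>
      rw [List.take_succ_cons, code, ih u (by simpa using h), code, pow_succ', Nat.mod_mul,
        show (2 * code u + (b : ℕ)) / 2 = code u by omega]
      omega

/-- `cond` in a form that the kernel evaluates faster. -/
noncomputable def branch {γ : Type} (b : Bool) (x y : γ) : γ := Bool.rec y x b

theorem branch_eq {γ : Type} (b : Bool) (x y : γ) : branch b x y = if b = true then x else y := by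
  cases b <;> rfl

/-- The code of the prefix (`side = false`) or suffix (`side = true`) of length `m` of the word of
length `n` with code `W`. -/
noncomputable def subcode (side : Bool) (W n m : ℕ) : ℕ :=
  branch side (Nat.shiftRight W (Nat.sub n m)) (Nat.add (Nat.mod W (Nat.pow 2 m)) (Nat.pow 2 m))

theorem exists_subcode (side : Bool) (u : List (Fin 2)) {m : ℕ} (h : m ≤ u.length) :
    ∃ v, v <:+: u ∧ v.length = m ∧ code v = subcode side (code u) u.length m := by
  cases side with
  | false => exact ⟨u.take m, (List.take_prefix _ _).isInfix, by simpa using h, code_take u h⟩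
  | true =>
    refine ⟨u.drop (u.length - m), (List.drop_suffix _ _).isInfix, by simp; omega, ?_⟩
    rw [code_drop u (by omega)]
    exact (Nat.shiftRight_eq_div_pow _ _).symm

/-- Whether the word with code `c` of length `p + q` has equal prefix and suffix of length `q`. -/
def hasPeriod (c p q : ℕ) : Bool :=
  Nat.beq (Nat.add (Nat.mod c (Nat.pow 2 q)) (Nat.pow 2 q)) (Nat.shiftRight c p)

theorem take_eq_drop {u : List (Fin 2)} {p q : ℕ} (hu : u.length = p + q)
    (h : hasPeriod (code u) p q = true) : u.take q = u.drop p := by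
  apply code_injective
  rw [code_take u (by omega), code_drop u (by omega)]
  exact (Nat.eq_of_beq_eq_true h).trans (Nat.shiftRight_eq_div_pow _ _)

theorem isSquareWord_of_hasPeriod {u : List (Fin 2)} {p : ℕ} (hp : 0 < p) (hu : u.length = p + p)
    (h : hasPeriod (code u) p p = true) : IsSquareWord u := by
  refine ⟨u.take p, ?_, ?_⟩
  · rw [← List.length_pos_iff, List.length_take]
    omega
  · conv_lhs => rw [← List.take_append_drop p u, ← take_eq_drop hu h]

theorem isOverlap_append_append (t : List (Fin 2)) (b : Fin 2) :
    IsOverlap ((b :: t) ++ (b :: t) ++ [b]) := by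
  refine ⟨b :: t, ⟨by simp, 2, [b], ⟨t, rfl⟩, by simp⟩, ?_⟩
  rw [lt_div_iff₀ (by simp; positivity)]
  norm_cast
  simp
  omega

theorem isOverlap_of_hasPeriod {u : List (Fin 2)} {p : ℕ} (hp : 0 < p) (hu : u.length = p + (p + 1))
    (h : hasPeriod (code u) p (p + 1) = true) : IsOverlap u := by
  have h1 := take_eq_drop hu h
  obtain ⟨b, t, ht⟩ : ∃ b t, u.take p = b :: t :=
    List.exists_cons_of_length_pos (by rw [List.length_take]; omega)
  have hl : (b :: t).length = p := by rw [← ht, List.length_take]; omega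
  have h2 : u = (b :: t) ++ u.drop p := by rw [← ht, List.take_append_drop]
  have h3 : u.drop p = (b :: t) ++ (u.drop p).take 1 := by
    conv_lhs => rw [← h1, h2, ← hl, List.take_length_add_append, hl]
  have h4 : (u.drop p).take 1 = [b] := by rw [h3]; rfl
  rw [h2, h3, h4, ← List.append_assoc]
  exact isOverlap_append_append t b

end Code

/-! ### The backtracking search and its soundness -/

section Search

/-- Applies `k` to `n`, but makes the kernel evaluate `n` first. -/
noncomputable def force (n : ℕ) (k : ℕ → Bool) : Bool :=
  Nat.rec (k 0) (fun m _ => k (Nat.succ m)) n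

theorem force_eq (n : ℕ) (k : ℕ → Bool) : force n k = k n := by
  cases n <;> rfl

noncomputable def memCode (c : ℕ) (l : List ℕ) : Bool :=
  List.rec false (fun d _ ih => branch (Nat.beq c d) true ih) l

theorem not_mem_of_memCode {c : ℕ} {l : List ℕ} (h : ¬ memCode c l = true) : c ∉ l := by
  induction l with
  | nil => simp
  | cons d l ih =>
    change ¬ branch (Nat.beq c d) true (memCode c l) = true at h
    rw [branch_eq] at h
    split at h
    · exact absurd rfl h
    · rename_i hb
      simp only [List.mem_cons, not_or]
      exact ⟨Nat.ne_of_beq_eq_false (Bool.eq_false_of_not_eq_true hb), ih h⟩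

/-- Whether some word with code in the list is a prefix (or suffix) of the word with code `W`. -/
noncomputable def hitsForbidden (side : Bool) (W n : ℕ) (l : List ℕ) : Bool :=
  -- `Nat.log2 f` is the length of the word with code `f`. That it fits into the word is tested only
  -- after a match, which is rare.
  List.rec false (fun f _ ih => branch (Nat.beq (subcode side W n (Nat.log2 f)) f)
    (branch (Nat.ble (Nat.log2 f) n) true ih) ih) l

/-- Tests the periods up to `p` at one end of the word with code `W` of length `n`. New squares are
added to the list `sq`, and an overlap other than `01010` ends the search with success. Periods that
are rejected by `filter` are skipped. -/
noncomputable def scan (side : Bool) (W n : ℕ) (filter : ℕ → Bool) (k : List ℕ → Bool) (p : ℕ) :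
    List ℕ → Bool :=
  Nat.rec (fun sq => k sq) (fun p ih sq => branch (filter p)
    (force (subcode side W n (Nat.add (p + 1) (p + 1))) fun c =>
      branch (hasPeriod c (p + 1) (p + 1))
        (branch (Nat.ble (Nat.add (p + 1) (p + 2)) n &&
            force (subcode side W n (Nat.add (p + 1) (p + 2))) fun d =>
              -- 42 is the code of 01010.
              hasPeriod d (p + 1) (p + 2) && !Nat.beq d 42)
          true
          (branch (memCode c sq) (ih sq) (ih (c :: sq))))
        (ih sq))
    (ih sq)) p

/-- A quick test that passes if `p + 1` is small or a period of the last (or first) `p + 13`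
letters. -/
noncomputable def quickFilter (side : Bool) (W n : ℕ) (k : (ℕ → Bool) → Bool) : Bool :=
  branch side
    (force (Nat.mod (Nat.shiftRight W (Nat.sub n 12)) 4096) fun q => force (Nat.sub n 13) fun m =>
      k fun p => branch (Nat.ble p 11) true
        (Nat.beq q (Nat.mod (Nat.shiftRight W (Nat.sub m p)) 4096)))
    (force (Nat.mod W 4096) fun q =>
      k fun p => branch (Nat.ble p 11) true (Nat.beq q (Nat.mod (Nat.shiftRight W (Nat.succ p)) 4096)))

/-- Soundness needs nothing about the filter: a skipped period can only lose squares and overlaps,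
which makes a refutation harder. -/
theorem exists_of_quickFilter {side : Bool} {W n : ℕ} {k : (ℕ → Bool) → Bool}
    (h : quickFilter side W n k = true) : ∃ filter, k filter = true := by
  rw [quickFilter, branch_eq] at h
  split at h
  · rw [force_eq, force_eq] at h
    exact ⟨_, h⟩
  · rw [force_eq] at h
    exact ⟨_, h⟩

/-- The code of the word that arises by putting the letter `b` at one end. -/
noncomputable def extendCode (side : Bool) (W n b : ℕ) : ℕ :=
  branch side (Nat.add W (Nat.mul (Nat.pow 2 n) (Nat.succ b))) (Nat.add (Nat.mul 2 W) b)

/-- Puts the letter `b` at one end and passes the new word and the new list of squares to `k`,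
unless the new word is impossible. -/
noncomputable def step (forb : List ℕ) (side : Bool) (W n : ℕ) (sq : List ℕ) (b : ℕ)
    (k : ℕ → ℕ → List ℕ → Bool) : Bool :=
  force (extendCode side W n b) fun W' => force (Nat.succ n) fun n' =>
    -- Testing one end suffices, because a forbidden factor or repetition that was not there before
    -- contains the new letter.
    branch (hitsForbidden side W' n' forb) true
      (quickFilter side W' n' fun filter => scan side W' n' filter
        (fun sq' => branch (Nat.ble 13 sq'.length) true (k W' n' sq')) (Nat.div n' 2) sq)

/-- Puts each of the two letters at one end. -/
noncomputable def extendBoth (forb : List ℕ) (side : Bool) (k : ℕ → ℕ → List ℕ → Bool) (W n : ℕ)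
    (sq : List ℕ) : Bool :=
  branch (step forb side W n sq 0 k) (step forb side W n sq 1 k) false

/-- Exhaustive search by extensions to the right and to the left in turn. -/
noncomputable def search (forb : List ℕ) (fuel : ℕ) : ℕ → ℕ → List ℕ → Bool :=
  Nat.rec (fun _ _ _ => false) (fun _ ih => extendBoth forb true (extendBoth forb false ih)) fuel

/-- Appends the letters of a word and then searches. -/
noncomputable def feed (forb : List ℕ) (fuel : ℕ) : List (Fin 2) → ℕ → ℕ → List ℕ → Bool
  | [], W, n, sq => search forb fuel W n sq
  | b :: u, W, n, sq => step forb true W n sq b (feed forb fuel u)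

/-- Refutes the words of a list one after the other. -/
noncomputable def refuteAll (fuel : ℕ) : List (List (Fin 2)) → List ℕ → Bool
  | [], _ => true
  | u :: l, forb => feed forb fuel u 1 0 [] && force (code u) fun c => refuteAll fuel l (c :: forb)

variable {L : Set (List (Fin 2))}

/-- The list consists of codes of distinct squares of `L`. -/
def IsSquareList (L : Set (List (Fin 2))) (sq : List ℕ) : Prop :=
  sq.Nodup ∧ ∀ c ∈ sq, ∃ u ∈ L, IsSquareWord u ∧ code u = c

theorem IsSquareList.length_le {sq : List ℕ} (h : IsSquareList L sq)
    (hsq : {v ∈ L | IsSquareWord v}.encard ≤ 12) : sq.length ≤ 12 := by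
  have h1 : (sq.toFinset : Set ℕ) ⊆ code '' {v ∈ L | IsSquareWord v} := by
    intro c hc
    obtain ⟨u, hu, hu', rfl⟩ := h.2 c (by simpa using hc)
    exact ⟨u, ⟨hu, hu'⟩, rfl⟩
  have h2 := (Set.encard_le_encard h1).trans ((Set.encard_image_le _ _).trans hsq)
  rw [Set.encard_coe_eq_coe_finsetCard, List.toFinset_card_of_nodup h.1] at h2
  exact_mod_cast h2

theorem hitsForbidden_eq_false (hL : IsExtendable L) {forb : List ℕ}
    (hforb : ∀ u ∈ L, code u ∉ forb) (side : Bool) {u : List (Fin 2)} (hu : u ∈ L) :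
    hitsForbidden side (code u) u.length forb = false := by
  induction forb with
  | nil => rfl
  | cons f l ih =>
    have ih := ih fun v hv h => hforb v hv (List.mem_cons_of_mem _ h)
    change branch _ (branch _ true (hitsForbidden side (code u) u.length l))
      (hitsForbidden side (code u) u.length l) = false
    rw [ih, branch_eq, branch_eq]
    split_ifs with h1 h2
    · obtain ⟨v, hv, -, hc⟩ := exists_subcode side u (Nat.le_of_ble_eq_true h2)
      rw [Nat.eq_of_beq_eq_true h1] at hc
      exact absurd (hc ▸ List.mem_cons_self) (hforb v (hL.mem_of_infix hv hu))
    · rfl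
    · rfl

/-- The exit through an overlap is impossible inside `L`, so success must come from the continuation
`k`, called with a list of squares that all belong to `L`. -/
theorem exists_of_scan (hL : IsExtendable L) (hov : ∀ v ∈ L, IsOverlap v → v = [0, 1, 0, 1, 0])
    (side : Bool) {u : List (Fin 2)} (hu : u ∈ L) (filter : ℕ → Bool) (k : List ℕ → Bool)
    (p : ℕ) (hp : p + p ≤ u.length)
    (sq : List ℕ) (hsq : IsSquareList L sq)
    (h : scan side (code u) u.length filter k p sq = true) : ∃ sq', IsSquareList L sq' ∧ k sq' = true := by
  induction p generalizing sq with
  | zero => exact ⟨sq, hsq, h⟩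
  | succ p ih =>
    obtain ⟨v, hv, hvl, hvc⟩ := exists_subcode side u hp
    have ih := fun sq => ih (by omega) sq
    change branch (filter p) (force (subcode side (code u) u.length (p + 1 + (p + 1))) fun c =>
      branch _ (branch _ true (branch _ (scan side (code u) u.length filter k p sq)
        (scan side (code u) u.length filter k p (c :: sq))))
        (scan side (code u) u.length filter k p sq))
      (scan side (code u) u.length filter k p sq) = true at h
    rw [force_eq, force_eq, ← hvc] at h
    simp only [branch_eq] at h
    split_ifs at h with h0 h1 h2 h3
    · rw [Bool.and_eq_true, Bool.and_eq_true] at h2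
      obtain ⟨x, hx, hxl, hxc⟩ := exists_subcode side u (Nat.le_of_ble_eq_true h2.1)
      have hxc' : subcode side (code u) u.length (Nat.add (p + 1) (p + 2)) = code x := hxc.symm
      rw [hxc'] at h2
      have hx01 := hov x (hL.mem_of_infix hx hu)
        (isOverlap_of_hasPeriod p.succ_pos hxl h2.2.1)
      rw [hx01] at h2
      exact absurd h2.2.2 (by decide)
    · exact ih sq hsq h
    · refine ih _ ⟨List.nodup_cons.2 ⟨not_mem_of_memCode h3, hsq.1⟩, ?_⟩ h
      rintro c hc
      rcases List.mem_cons.1 hc with rfl | hc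
      · exact ⟨v, hL.mem_of_infix hv hu, isSquareWord_of_hasPeriod p.succ_pos hvl h1, rfl⟩
      · exact hsq.2 c hc
    · exact ih sq hsq h
    · exact ih sq hsq h

theorem code_extend (side : Bool) (u : List (Fin 2)) (b : Fin 2) :
    extendCode side (code u) u.length b = code (cond side (u ++ [b]) (b :: u)) := by
  cases side with
  | false => rfl
  | true => exact (code_concat u b).symm

theorem exists_of_step (hL : IsExtendable L) (hov : ∀ v ∈ L, IsOverlap v → v = [0, 1, 0, 1, 0])
    (hsq : {v ∈ L | IsSquareWord v}.encard ≤ 12) {forb : List ℕ} (hforb : ∀ u ∈ L, code u ∉ forb)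
    (side : Bool) {u v : List (Fin 2)} {b : Fin 2} (hv : cond side (u ++ [b]) (b :: u) = v) (hvL : v ∈ L)
    (k : ℕ → ℕ → List ℕ → Bool) {sq : List ℕ} (h : IsSquareList L sq)
    (hs : step forb side (code u) u.length sq b k = true) :
    ∃ sq', IsSquareList L sq' ∧ k (code v) v.length sq' = true := by
  have hlen : u.length.succ = v.length := by rw [← hv]; cases side <;> simp
  rw [step, force_eq, force_eq, code_extend, hv, hlen,
    hitsForbidden_eq_false hL hforb side hvL, branch_eq, if_neg Bool.false_ne_true] at hs
  obtain ⟨filter, hs⟩ := exists_of_quickFilter hs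
  obtain ⟨sq', h1, h2⟩ := exists_of_scan hL hov side hvL _ _ _
    (by have : Nat.div v.length 2 = v.length / 2 := rfl; omega) sq h hs
  refine ⟨sq', h1, ?_⟩
  rw [branch_eq] at h2
  split_ifs at h2 with h3
  · have := Nat.le_of_ble_eq_true h3
    have := h1.length_le hsq
    omega
  · exact h2

/-- Success would refute both one-letter extensions, but by extendability one of them is in `L`. -/
theorem extendBoth_sound (hL : IsExtendable L) (hov : ∀ v ∈ L, IsOverlap v → v = [0, 1, 0, 1, 0])
    (hsq : {v ∈ L | IsSquareWord v}.encard ≤ 12) {forb : List ℕ} (hforb : ∀ u ∈ L, code u ∉ forb)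
    (side : Bool) {k : ℕ → ℕ → List ℕ → Bool}
    (hk : ∀ u ∈ L, ∀ sq, IsSquareList L sq → ¬ k (code u) u.length sq = true) :
    ∀ u ∈ L, ∀ sq, IsSquareList L sq → ¬ extendBoth forb side k (code u) u.length sq = true := by
  intro u hu sq h hs
  rw [extendBoth, branch_eq] at hs
  split_ifs at hs with h0
  obtain ⟨b, hb⟩ : ∃ b : Fin 2, cond side (u ++ [b]) (b :: u) ∈ L := by
    cases side with
    | false => exact hL.exists_cons hu
    | true => exact hL.exists_concat hu
  have hstep : step forb side (code u) u.length sq b k = true := by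
    match b with
    | 0 => exact h0
    | 1 => exact hs
  obtain ⟨sq', h2, h3⟩ := exists_of_step hL hov hsq hforb side rfl hb _ h hstep
  exact hk _ hb _ h2 h3

theorem search_sound (hL : IsExtendable L) (hov : ∀ v ∈ L, IsOverlap v → v = [0, 1, 0, 1, 0])
    (hsq : {v ∈ L | IsSquareWord v}.encard ≤ 12) {forb : List ℕ} (hforb : ∀ u ∈ L, code u ∉ forb)
    (fuel : ℕ) :
    ∀ u ∈ L, ∀ sq, IsSquareList L sq → ¬ search forb fuel (code u) u.length sq = true := by
  induction fuel with
  | zero => exact fun _ _ _ _ => Bool.false_ne_true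
  | succ fuel ih =>
    exact extendBoth_sound hL hov hsq hforb true (extendBoth_sound hL hov hsq hforb false ih)

theorem feed_sound (hL : IsExtendable L) (hov : ∀ v ∈ L, IsOverlap v → v = [0, 1, 0, 1, 0])
    (hsq : {v ∈ L | IsSquareWord v}.encard ≤ 12) {forb : List ℕ} (hforb : ∀ u ∈ L, code u ∉ forb)
    (fuel : ℕ) {u v : List (Fin 2)} (hu : u ++ v ∈ L) {sq : List ℕ} (h : IsSquareList L sq) :
    ¬ feed forb fuel v (code u) u.length sq = true := by
  induction v generalizing u sq with
  | nil =>
    rw [List.append_nil] at hu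
    exact search_sound hL hov hsq hforb fuel u hu sq h
  | cons b v ih =>
    rw [feed]
    intro hs
    have hu' : (u ++ [b]) ++ v ∈ L := by simpa using hu
    obtain ⟨sq', h2, h3⟩ := exists_of_step hL hov hsq hforb true rfl
      (hL.mem_of_infix (List.prefix_append _ _).isInfix hu') _ h hs
    exact ih hu' h2 h3

theorem refuteAll_sound (hL : IsExtendable L) (hov : ∀ v ∈ L, IsOverlap v → v = [0, 1, 0, 1, 0])
    (hsq : {v ∈ L | IsSquareWord v}.encard ≤ 12) (fuel : ℕ) (l : List (List (Fin 2)))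
    {forb : List ℕ} (hforb : ∀ u ∈ L, code u ∉ forb) (h : refuteAll fuel l forb = true) :
    ∀ u ∈ l, u ∉ L := by
  induction l generalizing forb with
  | nil => simp
  | cons v l ih =>
    rw [refuteAll, Bool.and_eq_true, force_eq] at h
    have hv : v ∉ L := fun hv => by
      exact feed_sound hL hov hsq hforb fuel (u := []) hv (sq := []) ⟨List.nodup_nil, by simp⟩ h.1
    rintro u hu
    rcases List.mem_cons.1 hu with rfl | hu
    · exact hv
    · refine ih ?_ h.2 u hu
      rintro x hx hc
      rcases List.mem_cons.1 hc with hc | hc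
      · exact hv (code_injective hc ▸ hx)
      · exact hforb x hx hc

end Search

/-! ### The refuted words -/

/-- The minimal words of length at most `39` that do not occur in `h₁₂(b₅)`. -/
def forbidden : List (List (Fin 2)) :=
  [ [0, 0, 0],
    [1, 1, 1],
    [1, 0, 1, 0, 1],
    [0, 0, 1, 1, 0, 0, 1, 1],
    [1, 1, 0, 0, 1, 1, 0, 0],
    [0, 1, 0, 0, 1, 1, 0, 1, 0, 0, 1, 1],
    [1, 1, 0, 0, 1, 0, 1, 1, 0, 0, 1, 0],
    [1, 1, 0, 1, 1],
    [0, 0, 1, 0, 0],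
    [0, 1, 0, 0, 1, 0, 1, 0],
    [1, 0, 1, 1, 0, 0, 1, 0, 1, 1],
    [1, 1, 0, 1, 0, 0, 1, 1, 0, 1],
    [0, 1, 0, 1, 0, 0, 1, 0],
    [0, 0, 1, 1, 0, 0, 1, 0, 1, 0, 0, 1, 1, 0, 0],
    [0, 1, 0, 1, 0, 0, 1, 1, 0, 0, 1, 0, 1, 0],
    [1, 1, 0, 0, 1, 1, 0, 1, 0, 0, 1, 0, 1, 1, 0, 0, 1, 1],
    [1, 0, 1, 1, 0, 0, 1, 0, 1, 0, 0, 1, 1, 0, 1, 0, 0, 1, 0, 1, 1, 0, 0, 1, 0],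
    [0, 1, 0, 0, 1, 1, 0, 1, 0, 0, 1, 0, 1, 1, 0, 0, 1, 0, 1, 0, 0, 1, 1, 0, 1],
    [1, 0, 1, 1, 0, 1],
    [0, 1, 0, 0, 1, 0, 1, 1, 0, 0, 1, 1, 0, 1, 0, 0, 1, 0],
    [1, 1, 0, 0, 1, 0, 1, 1, 0, 0, 1, 1, 0, 1, 0, 0, 1, 1, 0, 0, 1, 0, 1, 1],
    [1, 1, 0, 1, 0, 0, 1, 1, 0, 0, 1, 0, 1, 1, 0, 0, 1, 1, 0, 1, 0, 0, 1, 1],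
    [0, 1, 0, 1, 0, 0, 1, 1, 0, 0, 1, 0, 1, 1, 0, 0, 1, 1, 0, 1, 0, 0, 1, 0, 1, 1, 0, 0, 1, 0, 1, 0, 0, 1, 1, 0, 0],
    [0, 0, 1, 1, 0, 0, 1, 0, 1, 0, 0, 1, 1, 0, 1, 0, 0, 1, 0, 1, 1, 0, 0, 1, 1, 0, 1, 0, 0, 1, 1, 0, 0, 1, 0, 1, 0],
    [0, 1, 0, 0, 1, 0, 1, 1, 0, 0, 1, 1, 0, 1, 0, 0, 1, 1, 0, 0, 1, 0, 1, 0, 0, 1, 1, 0, 1, 0, 0, 1, 0, 1, 1, 0, 0, 1, 1],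
    [1, 1, 0, 0, 1, 1, 0, 1, 0, 0, 1, 0, 1, 1, 0, 0, 1, 0, 1, 0, 0, 1, 1, 0, 0, 1, 0, 1, 1, 0, 0, 1, 1, 0, 1, 0, 0, 1, 0]]

-- The list is not ordered by length: each refutation may prune with all words before it. One unit
-- of the fuel 200 stands for one letter on the right and one on the left; running out of fuel
-- counts as failure.
set_option maxRecDepth 100000 in
theorem refuteAll_forbidden : refuteAll 200 forbidden [] = true := by
  decide +kernel

/-! ### Cutting into blocks of `h12phi` and of `phi5` -/

section Parsing

variable {α : Type*} [DecidableEq α]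

/-- The words of length `n` over the given letters without factors in `F`. -/
def wordsAvoiding (F : List (List α)) (letters : List α) : ℕ → List (List α)
  | 0 => [[]]
  | n + 1 => (wordsAvoiding F letters n).flatMap fun u =>
      (letters.map (· :: u)).filter fun v => !F.any (·.isPrefixOf v)

theorem mem_wordsAvoiding {L : Set (List α)} (hL : IsExtendable L) {F : List (List α)}
    (hF : ∀ u ∈ F, u ∉ L) {letters : List α} (hl : ∀ a, a ∈ letters) (n : ℕ) :
    ∀ u ∈ L, u.length = n → u ∈ wordsAvoiding F letters n := by
  induction n with
  | zero =>
    intro u _ h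
    simp [wordsAvoiding, List.length_eq_zero_iff.1 h]
  | succ n ih =>
    rintro (_ | ⟨a, u⟩) hu h
    · simp at h
    · refine List.mem_flatMap.2 ⟨u, ih u (hL.mem_of_infix (List.suffix_cons a u).isInfix hu)
        (by simpa using h), List.mem_filter.2 ⟨List.mem_map_of_mem (hl a), ?_⟩⟩
      simp only [Bool.not_eq_true', List.any_eq_false, List.isPrefixOf_iff_prefix]
      exact fun f hf hp => hF f hf (hL.mem_of_infix hp.isInfix hu)

/-- The morphism `h₁₂ ∘ φ³`. -/
def h12phi : Fin 5 → List (Fin 2) := fun a => applyMorphism h12 ((applyMorphism phi5)^[3] [a])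

/-- The words of length at least two and different from squares that characterise `b₅`. -/
def b5Forbidden : List (List (Fin 5)) :=
  [[0, 2], [0, 3], [1, 3], [1, 4], [2, 0], [2, 4], [3, 1], [3, 2], [4, 0], [4, 1], [4, 3],
    [1, 2, 1], [2, 1, 2], [3, 0, 4], [3, 4, 2, 3], [4, 2, 3, 4]]

/-- Extendable square-free languages that avoid `b5Forbidden`. -/
structure IsB5Language (M : Set (List (Fin 5))) : Prop where
  isExtendable : IsExtendable M
  squareFree : ∀ u : List (Fin 5), u ≠ [] → u ++ u ∉ M
  avoids : ∀ u ∈ b5Forbidden, u ∉ M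

-- The longest block, that of the letter 0, has 17 letters; with the marker 0011 this gives windows
-- of length 21. There are few such windows without forbidden factors, and all are checked.
set_option maxRecDepth 100000 in
theorem isCut_h12phi {L : Set (List (Fin 2))} (hL : IsExtendable L) (hF : ∀ u ∈ forbidden, u ∉ L) :
    IsCut h12phi [[0, 0, 1, 1]] 21 L := by
  have key : ∀ u ∈ wordsAvoiding forbidden [0, 1] 21,
      (∃ m ∈ ([[0, 0, 1, 1]] : List (List (Fin 2))), m <:+: u) ∧
      (∀ m ∈ ([[0, 0, 1, 1]] : List (List (Fin 2))), m <+: u →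
        ∃ a, ∃ m' ∈ ([[0, 0, 1, 1]] : List (List (Fin 2))), h12phi a ++ m' <+: u) ∧
      ∀ m ∈ ([[0, 0, 1, 1]] : List (List (Fin 2))), m <:+ u → ∃ a, h12phi a ++ m <:+ u := by
    decide +kernel
  have hmem := fun u hu h => key u (mem_wordsAvoiding hL hF (letters := [0, 1]) (by decide) 21 u hu h)
  exact
    { ne_nil := by decide +kernel
      marker_prefix := by decide +kernel
      length_le := by decide
      exists_marker := fun u hu h => (hmem u hu h).1
      right := fun u hu h => (hmem u hu h).2.1
      left := fun u hu h => (hmem u hu h).2.2 }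

theorem applyMorphism_ne_nil {β γ : Type*} {f : β → List γ} (hf : ∀ a, f a ≠ []) {u : List β}
    (hu : u ≠ []) : applyMorphism f u ≠ [] := by
  cases u with
  | nil => exact absurd rfl hu
  | cons a u => simp [applyMorphism_cons, hf a]

-- All blocks and the marker begin with 0. A square in the desubstituted language therefore yields a
-- square in `L` followed by its own first letter, which is an overlap.
set_option maxRecDepth 100000 in
theorem isB5Language_desubstitution_h12phi {L : Set (List (Fin 2))} (hL : IsExtendable L)
    (hov : ∀ v ∈ L, IsOverlap v → v = [0, 1, 0, 1, 0]) (hF : ∀ u ∈ forbidden, u ∉ L) :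
    IsB5Language (desubstitution h12phi [[0, 0, 1, 1]] L) where
  isExtendable := (isCut_h12phi hL hF).isExtendable hL
  squareFree := by
    rintro (_ | ⟨a, u⟩) hu ⟨m, hm, h⟩
    · exact hu rfl
    · rw [List.mem_singleton.1 hm, applyMorphism_append] at h
      -- The shortest block is 001101, so the overlap has at least 13 letters and is not 01010.
      have ha : ∀ a, h12phi a = 0 :: (h12phi a).tail ∧ 6 ≤ (h12phi a).length := by decide +kernel
      obtain ⟨ha, hlen⟩ := ha a
      have hu : applyMorphism h12phi (a :: u) =
          0 :: ((h12phi a).tail ++ applyMorphism h12phi u) := by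
        rw [applyMorphism_cons, ← List.cons_append, ← ha]
      rw [hu] at h
      have hovl := isOverlap_append_append ((h12phi a).tail ++ applyMorphism h12phi u) 0
      have := congrArg List.length
        (hov _ (hL.mem_of_infix (List.IsPrefix.isInfix ⟨[0, 1, 1], by simp⟩) h) hovl)
      simp only [List.length_append, List.length_cons, List.length_nil, List.length_tail] at this
      omega
  avoids := by
    have key : ∀ u ∈ b5Forbidden, ∃ f ∈ forbidden, f <:+: applyMorphism h12phi u ++ [0, 0, 1, 1] := by
      decide +kernel
    rintro u hu ⟨m, hm, h⟩
    rw [List.mem_singleton.1 hm] at h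
    obtain ⟨f, hf, hfu⟩ := key u hu
    exact hF f hf (hL.mem_of_infix hfu h)

/-- Whether a word has a square prefix. -/
def hasSquarePrefix (u : List α) : Bool :=
  (List.range u.length).any fun p => (u.take (p + 1)).isPrefixOf (u.drop (p + 1))

/-- Whether a word contains a square or a word of `b5Forbidden`. -/
def isBad (u : List (Fin 5)) : Bool :=
  u.tails.any fun v => hasSquarePrefix v || b5Forbidden.any (·.isPrefixOf v)

theorem IsB5Language.isBad_eq_false {M : Set (List (Fin 5))} (hM : IsB5Language M)
    {u : List (Fin 5)} (hu : u ∈ M) : ¬ isBad u = true := by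
  intro h
  obtain ⟨v, hv, h⟩ := List.any_eq_true.1 h
  have hvM := hM.isExtendable.mem_of_infix ((List.mem_tails _ _).1 hv).isInfix hu
  rcases Bool.or_eq_true_iff.1 h with h | h
  · obtain ⟨p, hp, h⟩ := List.any_eq_true.1 h
    have hp := List.mem_range.1 hp
    refine hM.squareFree (v.take (p + 1)) (List.length_pos_iff.1 (by rw [List.length_take]; omega))
      (hM.isExtendable.mem_of_infix (List.IsPrefix.isInfix ?_) hvM)
    conv_rhs => rw [← List.take_append_drop (p + 1) v]
    exact (List.prefix_append_right_inj _).2 (List.isPrefixOf_iff_prefix.1 h)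
  · obtain ⟨f, hf, h⟩ := List.any_eq_true.1 h
    exact hM.avoids f hf (hM.isExtendable.mem_of_infix (List.isPrefixOf_iff_prefix.1 h).isInfix hvM)

-- Each block of `phi5` is an even letter, possibly followed by an odd one, so even letters mark the
-- beginnings of blocks. Windows of length 3 hold a longest block and a marker.
set_option maxRecDepth 100000 in
theorem IsB5Language.isCut {M : Set (List (Fin 5))} (hM : IsB5Language M) :
    IsCut phi5 [[0], [2], [4]] 3 M := by
  have key : ∀ x y z : Fin 5, isBad [x, y, z] = false →
      (∃ m ∈ ([[0], [2], [4]] : List (List (Fin 5))), m <:+: [x, y, z]) ∧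
      (∀ m ∈ ([[0], [2], [4]] : List (List (Fin 5))), m <+: [x, y, z] →
        ∃ a, ∃ m' ∈ ([[0], [2], [4]] : List (List (Fin 5))), phi5 a ++ m' <+: [x, y, z]) ∧
      ∀ m ∈ ([[0], [2], [4]] : List (List (Fin 5))), m <:+ [x, y, z] →
        ∃ a, phi5 a ++ m <:+ [x, y, z] := by
    decide +kernel
  have hmem := fun (x y z : Fin 5) (h : [x, y, z] ∈ M) =>
    key x y z (Bool.eq_false_of_not_eq_true (hM.isBad_eq_false h))
  refine
    { ne_nil := by decide +kernel
      marker_prefix := by decide +kernel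
      length_le := by decide
      exists_marker := fun u hu h => ?_
      right := fun u hu h => ?_
      left := fun u hu h => ?_ }
  all_goals obtain ⟨x, y, z, rfl⟩ := List.length_eq_three.1 h
  · exact (hmem x y z hu).1
  · exact (hmem x y z hu).2.1
  · exact (hmem x y z hu).2.2

-- A square has a square as its image. For the words of `b5Forbidden` a letter of context on each
-- side is taken along: 3423, for instance, can only stand between 2 and one of 0 and 4, and then
-- its image extends to the square 42104210.
set_option maxRecDepth 100000 in
theorem IsB5Language.desubstitution {M : Set (List (Fin 5))} (hM : IsB5Language M) :
    IsB5Language (desubstitution phi5 [[0], [2], [4]] M) where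
  isExtendable := hM.isCut.isExtendable hM.isExtendable
  squareFree := by
    intro u hu h
    have := applyMorphism_mem_of_mem_desubstitution hM.isExtendable h
    rw [applyMorphism_append] at this
    exact hM.squareFree _ (applyMorphism_ne_nil hM.isCut.ne_nil hu) this
  avoids := by
    have key : ∀ u ∈ b5Forbidden, ∀ d e : Fin 5, ∀ m ∈ ([[0], [2], [4]] : List (List (Fin 5))),
        isBad (applyMorphism phi5 (d :: (u ++ [e])) ++ m) = true := by
      decide +kernel
    intro u hu h
    have hext := hM.isCut.isExtendable hM.isExtendable
    obtain ⟨e, he⟩ := hext.exists_concat h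
    obtain ⟨d, m, hm, hd⟩ := hext.exists_cons he
    exact hM.isBad_eq_false hd (key u hu d e m hm)

end Parsing

/-! ### Iterated morphisms and factors of infinite words -/

section Iteration

variable {α β : Type*}

theorem iterate_nil (f : α → List α) (n : ℕ) : (applyMorphism f)^[n] [] = [] := by
  induction n with
  | zero => rfl
  | succ n ih => rw [Function.iterate_succ_apply]; exact ih

theorem iterate_eq_applyMorphism (f : α → List α) (n : ℕ) (u : List α) :
    (applyMorphism f)^[n] u = applyMorphism (fun a => (applyMorphism f)^[n] [a]) u := by
  induction u with
  | nil => exact iterate_nil f n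
  | cons a u ih => rw [applyMorphism_cons, ← ih, ← iterate_append, List.singleton_append]

theorem applyMorphism_comp {γ : Type*} (f : α → List β) (g : β → List γ) (u : List α) :
    applyMorphism g (applyMorphism f u) = applyMorphism (fun a => applyMorphism g (f a)) u := by
  simp [applyMorphism, List.flatMap_assoc]

theorem iterate_infix (f : α → List α) (n : ℕ) {u v : List α} (h : u <:+: v) :
    (applyMorphism f)^[n] u <:+: (applyMorphism f)^[n] v := by
  obtain ⟨s, t, rfl⟩ := h
  exact ⟨(applyMorphism f)^[n] s, (applyMorphism f)^[n] t, by simp only [iterate_append]⟩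

/-- A short factor of `f v` lies in the image of a factor of `v` of length at most two. -/
theorem exists_short_infix {f : α → List β} {u : List β} (hf : ∀ a, u.length ≤ (f a).length)
    (v : List α) (h : u <:+: applyMorphism f v) :
    ∃ x, x <:+: v ∧ x.length ≤ 2 ∧ u <:+: applyMorphism f x := by
  induction v with
  | nil => exact ⟨[], List.infix_refl _, by simp, h⟩
  | cons a v ih =>
    obtain ⟨p, q, hpq⟩ := h
    rw [applyMorphism_cons, List.append_assoc] at hpq
    rcases List.append_eq_append_iff.1 hpq with ⟨r, hr, hr'⟩ | ⟨r, hr, hr'⟩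
    · cases v with
      | nil => exact ⟨[a], List.infix_refl _, by simp, p, q, by
          rw [applyMorphism_cons, List.append_assoc, hpq]⟩
      | cons b v =>
        refine ⟨[a, b], ⟨[], v, rfl⟩, by simp, ?_⟩
        have h1 : p ++ u <+: f a ++ (f b ++ applyMorphism f v) :=
          ⟨q, by rw [List.append_assoc, hpq, applyMorphism_cons]⟩
        have h2 : f a ++ f b <+: f a ++ (f b ++ applyMorphism f v) :=
          ⟨applyMorphism f v, List.append_assoc _ _ _⟩
        have h3 := List.prefix_of_prefix_length_le h1 h2 (by
          have := hf b
          have := congrArg List.length hr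
          simp only [List.length_append] at this ⊢
          omega)
        refine (List.suffix_append p u).isInfix.trans ?_
        simpa [applyMorphism] using h3.isInfix
    · obtain ⟨x, hx, hx2, hux⟩ := ih ⟨r, q, by rw [hr', List.append_assoc]⟩
      exact ⟨x, hx.trans (List.suffix_cons a v).isInfix, hx2, hux⟩

theorem length_le_length_applyMorphism {f : α → List β} (hf : ∀ a, f a ≠ []) (u : List α) :
    u.length ≤ (applyMorphism f u).length := by
  induction u with
  | nil => simp
  | cons a u ih =>
    have := List.length_pos_iff.2 (hf a)
    rw [applyMorphism_cons, List.length_append, List.length_cons]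
    omega

theorem mem_factors_iff {x : ℕ → α} {u : List α} :
    u ∈ factors x ↔ ∃ n, ∀ m, n ≤ m → u <:+: pre x m := by
  constructor
  · rintro ⟨i, n, rfl⟩
    refine ⟨i + n, fun m hm => ?_⟩
    refine List.IsInfix.trans ?_ (pre_prefix x hm).isInfix
    refine ⟨pre x i, [], ?_⟩
    simp [pre, List.range_add]
  · rintro ⟨n, h⟩
    obtain ⟨s, t, hst⟩ := h n le_rfl
    refine ⟨s.length, u.length, List.ext_getElem (by simp) fun k h1 h2 => ?_⟩
    have h3 : (s ++ u ++ t)[s.length + k]'(by simp; omega) = x (s.length + k) := by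
      simp only [hst]
      simp [pre]
    rw [List.getElem_append_left (by simp; omega),
      List.getElem_append_right (by omega)] at h3
    simpa using h3

theorem mem_factors_of_infix {x : ℕ → α} {u : List α} {n : ℕ} (h : u <:+: pre x n) :
    u ∈ factors x :=
  mem_factors_iff.2 ⟨n, fun _ hm => h.trans (pre_prefix x hm).isInfix⟩

end Iteration

/-! ### Comparison with the factors of `h12(b5)` -/

section Factors

theorem zero_infix_iterate_three (a : Fin 5) : [0] <:+: (applyMorphism phi5)^[3] [a] := by
  revert a
  decide +kernel

/-- Three steps produce a 0 from any letter, and the remaining `n` steps make it grow. -/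
theorem lt_length_iterate (n : ℕ) (a : Fin 5) :
    n < ((applyMorphism phi5)^[n + 3] [a]).length := by
  have h := (iterate_infix phi5 n (zero_infix_iterate_three a)).length_le
  rw [← Function.iterate_add_apply] at h
  exact (phi5_iterate_length n).trans_le h

theorem h12phi_applyMorphism (u : List (Fin 5)) :
    applyMorphism h12phi u = applyMorphism h12 ((applyMorphism phi5)^[3] u) := by
  rw [iterate_eq_applyMorphism, applyMorphism_comp]
  rfl

-- Only nine pairs of letters are neither squares nor in `b5Forbidden`, and the eighth iterate
-- already contains all of them.
set_option maxRecDepth 100000 in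
theorem IsB5Language.infix_iterate {M : Set (List (Fin 5))} (hM : IsB5Language M)
    {u : List (Fin 5)} (hu : u ∈ M) (hlen : u.length ≤ 2) :
    u <:+: (applyMorphism phi5)^[8] [0] := by
  have key : ∀ a b : Fin 5, isBad [a, b] = false → [a, b] <:+: (applyMorphism phi5)^[8] [0] := by
    decide +kernel
  obtain ⟨s, hs, hus⟩ := hM.isExtendable.exists_append_right hu (2 - u.length)
  obtain ⟨a, b, hab⟩ := List.length_eq_two.1 (show (u ++ s).length = 2 by simp; omega)
  refine (List.prefix_append u s).isInfix.trans ?_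
  rw [hab] at hus ⊢
  exact key a b (Bool.eq_false_of_not_eq_true (hM.isBad_eq_false hus))

/-- Repeated desubstitution. -/
theorem exists_isB5Language {L : Set (List (Fin 2))} (hL : IsExtendable L)
    (hov : ∀ v ∈ L, IsOverlap v → v = [0, 1, 0, 1, 0]) (hF : ∀ u ∈ forbidden, u ∉ L) (n : ℕ) :
    ∃ M, IsB5Language M ∧
      (∀ v ∈ M, applyMorphism h12phi ((applyMorphism phi5)^[n] v) ∈ L) ∧
      ∀ u ∈ L, ∃ v ∈ M, u <:+: applyMorphism h12phi ((applyMorphism phi5)^[n] v) := by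
  induction n with
  | zero =>
    exact ⟨_, isB5Language_desubstitution_h12phi hL hov hF,
      fun v hv => applyMorphism_mem_of_mem_desubstitution hL hv,
      fun u hu => (isCut_h12phi hL hF).exists_infix hL hu⟩
  | succ n ih =>
    obtain ⟨M, hM, h1, h2⟩ := ih
    refine ⟨_, hM.desubstitution, fun v hv => ?_, fun u hu => ?_⟩
    · rw [Function.iterate_succ_apply]
      exact h1 _ (applyMorphism_mem_of_mem_desubstitution hM.isExtendable hv)
    · obtain ⟨v, hv, huv⟩ := h2 u hu
      obtain ⟨x, hx, hvx⟩ := hM.isCut.exists_infix hM.isExtendable hv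
      refine ⟨x, hx, huv.trans ?_⟩
      rw [Function.iterate_succ_apply]
      exact applyMorphism_infix _ (iterate_infix _ _ hvx)

theorem eq_factors {L : Set (List (Fin 2))} (hL : IsExtendable L)
    (hov : ∀ v ∈ L, IsOverlap v → v = [0, 1, 0, 1, 0]) (hF : ∀ u ∈ forbidden, u ∉ L) :
    L = factors (image h12 b5) := by
  have hne : ∀ a, h12phi a ≠ [] := (isCut_h12phi hL hF).ne_nil
  ext u
  constructor
  · intro hu
    -- With this exponent the image of each single letter is at least as long as `u`, so `u` meets
    -- at most two of them.
    obtain ⟨M, hM, -, h⟩ := exists_isB5Language hL hov hF (u.length + 3)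
    obtain ⟨v, hv, huv⟩ := h u hu
    rw [iterate_eq_applyMorphism, applyMorphism_comp] at huv
    obtain ⟨x, hxv, hx2, hux⟩ := exists_short_infix (fun a =>
      (lt_length_iterate u.length a).le.trans (length_le_length_applyMorphism hne _)) v huv
    rw [← applyMorphism_comp, ← iterate_eq_applyMorphism, h12phi_applyMorphism,
      ← Function.iterate_add_apply] at hux
    have hx := hM.infix_iterate (hM.isExtendable.mem_of_infix hxv hv) hx2
    have hux := hux.trans (applyMorphism_infix h12 (iterate_infix phi5 _ hx))
    rw [← Function.iterate_add_apply, ← pre_b5, ← pre_image] at hux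
    exact mem_factors_of_infix hux
  · intro hu
    obtain ⟨n, hn⟩ := mem_factors_iff.1 hu
    obtain ⟨k, hk⟩ := h12_b5_length n
    -- Three steps bring a 0 out of the letter `a`; the other `k`, with the three inside `h12phi`,
    -- make its image a prefix of `h12(b5)` long enough to contain `u`.
    obtain ⟨M, hM, h, -⟩ := exists_isB5Language hL hov hF (k + 3)
    obtain ⟨a, ha⟩ := hM.isExtendable.exists_cons hM.isExtendable.nil_mem
    have hlen : k ≤ ((applyMorphism phi5)^[3 + k] [0]).length :=
      ((Nat.le_add_left k 3).trans_lt (phi5_iterate_length _)).le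
    have hp := (applyMorphism_prefix h12 (pre_prefix b5 hlen)).length_le
    have hu' := hn _ (hk.le.trans hp)
    rw [pre_image, pre_b5, Function.iterate_add_apply, ← h12phi_applyMorphism] at hu'
    refine hL.mem_of_infix (hu'.trans ?_) (h [a] ha)
    rw [Function.iterate_add_apply]
    exact applyMorphism_infix _ (iterate_infix _ _ (zero_infix_iterate_three a))

end Factors

end Words

theorem mainTheorem3 (w : ℤ → Fin 2)
    (hoverlap : ∀ v ∈ Words.biFactors w, Words.IsOverlap v → v = [0, 1, 0, 1, 0])
    (hsquares : {v ∈ Words.biFactors w | Words.IsSquareWord v}.encard ≤ 12) :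
    Words.biFactors w = Words.factors (Words.image Words.h12 Words.b5) := by
  have hL := Words.isExtendable_biFactors w
  exact Words.eq_factors hL hoverlap
    (Words.refuteAll_sound hL hoverlap hsquares 200 _ (by simp) Words.refuteAll_forbidden)
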